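/- Let $\mathbb{T}_1,\mathbb{T}_2$ be time scales (nonempty closed subsets of $\mathbb{R}$) with at least two points each, let $a_1\in\mathbb{T}_1$, $a_2\in\mathbb{T}_2$, and put $\tilde{\mathbb{T}}_i=[a_i,\infty)\cap\mathbb{T}_i$. Let $u,a,f:\tilde{\mathbb{T}}_1\times\tilde{\mathbb{T}}_2\to[0,\infty)$ be continuous, with $a$ nondecreasing in each of its variables. If $$u(t_1,t_2)\le a(t_1,t_2)+\int_{a_1}^{t_1}\int_{a_2}^{t_2} f(s_1,s_2)\,u(s_1,s_2)\,\Delta_1 s_1\Delta_2 s_2\qquad\text{for all }(t_1,t_2)\in\tilde{\mathbb{T}}_1\times\tilde{\mathbb{T}}_2,$$ where the right-hand side contains the (Riemann) double delta integral over $[a_1,t_1)\times[a_2,t_2)$, then $$u(t_1,t_2)\le a(t_1,t_2)\,e_{p_{t_2}}(t_1,a_1)\qquad\text{for all }(t_1,t_2)\in\tilde{\mathbb{T}}_1\times\tilde{\mathbb{T}}_2,$$ where $p_{t_2}(s_1)=\int_{a_2}^{t_2} f(s_1,s_2)\,\Delta_2 s_2$ for $s_1\in\tilde{\mathbb{T}}_1$,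 with $t_2$ held fixed. Here $e_p$ is the exponential function of the time scale $\mathbb{T}_1$, $$e_p(t,s)=\exp\left(\int_s^t \xi_{\mu_1(\tau)}(p(\tau))\,\Delta_1\tau\right),\qquad \xi_h(z)=\frac{\log(1+hz)}{h}\ (h>0),\quad \xi_0(z)=z,$$ $\mu_1(\tau)=\sigma_1(\tau)-\tau$ is the graininess, and $\sigma_1(\tau)=\inf\{s\in\mathbb{T}_1: s>\tau\}$ (with $\sigma_1(\tau)=\tau$ if $\tau=\max\mathbb{T}_1$) is the forward jump operator. -/

import Mathlib

/-- A time scale: a nonempty closed subset of the real line. -/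
def IsTimeScale (T : Set ℝ) : Prop := T.Nonempty ∧ IsClosed T

/-- The time scale interval `[a, ∞) ∩ T`. -/
def tsIci (T : Set ℝ) (a : ℝ) : Set ℝ := Set.Ici a ∩ T

open Classical in
/-- The forward jump operator `σ(t) = inf {s ∈ T : s > t}`, with `σ(t) = t` when `t` is the
maximum of `T`. -/
noncomputable def forwardJump (T : Set ℝ) (t : ℝ) : ℝ :=
  if (T ∩ Set.Ioi t).Nonempty then sInf (T ∩ Set.Ioi t) else t

/-- The graininess `μ(t) = σ(t) - t`. -/
noncomputable def graininess (T : Set ℝ) (t : ℝ) : ℝ := forwardJump T t - t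

/-- A partition `a = t₀ < t₁ < ⋯ < tₙ = b` of `[a, b)` by points of the time scale `T`. -/
structure DeltaPartition (T : Set ℝ) (a b : ℝ) where
  /-- the number of cells -/
  n : ℕ
  /-- the partition points -/
  pt : Fin (n + 1) → ℝ
  strictMono : StrictMono pt
  mem : ∀ i, pt i ∈ T
  first : pt 0 = a
  last : pt (Fin.last n) = b

namespace DeltaPartition

variable {T : Set ℝ} {a b : ℝ}

/-- The length of the `i`-th cell. -/
def len (P : DeltaPartition T a b) (i : Fin P.n) : ℝ := P.pt i.succ - P.pt i.castSucc

/-- The `i`-th cell `[tᵢ, tᵢ₊₁) ∩ T`. -/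
def cell (P : DeltaPartition T a b) (i : Fin P.n) : Set ℝ :=
  Set.Ico (P.pt i.castSucc) (P.pt i.succ) ∩ T

/-- The partition has mesh at most `δ` in the sense of time scales: each cell either has length
at most `δ` or is a jump of `T` from one point to the next one. -/
def Fine (P : DeltaPartition T a b) (δ : ℝ) : Prop :=
  ∀ i : Fin P.n, P.len i ≤ δ ∨ forwardJump T (P.pt i.castSucc) = P.pt i.succ

end DeltaPartition

/-- `I` is the Riemann delta integral of `g` over `[a, b) ∩ T`, for `a ≤ b` in `T`: the Riemann
delta sums converge to `I`, uniformly in the tags, as the mesh tends to zero. -/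
def HasDeltaIntegral (T : Set ℝ) (g : ℝ → ℝ) (a b I : ℝ) : Prop :=
  ∀ ε > 0, ∃ δ > 0, ∀ P : DeltaPartition T a b, P.Fine δ →
    ∀ ξ : Fin P.n → ℝ, (∀ i, ξ i ∈ P.cell i) →
      |∑ i, g (ξ i) * P.len i - I| < ε

/-- `I` is the Riemann double delta integral of `g` over the rectangle
`([a₁, b₁) ∩ T₁) × ([a₂, b₂) ∩ T₂)`, for `aᵢ ≤ bᵢ` in `Tᵢ`. The tag of the cell with index
`(i, j)` is the point `ξ i j`, which may depend on both indices. -/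
def HasDeltaIntegral₂ (T₁ T₂ : Set ℝ) (g : ℝ → ℝ → ℝ) (a₁ b₁ a₂ b₂ I : ℝ) : Prop :=
  ∀ ε > 0, ∃ δ > 0, ∀ (P : DeltaPartition T₁ a₁ b₁) (Q : DeltaPartition T₂ a₂ b₂),
    P.Fine δ → Q.Fine δ →
    ∀ ξ : Fin P.n → Fin Q.n → ℝ × ℝ, (∀ i j, ξ i j ∈ P.cell i ×ˢ Q.cell j) →
      |∑ i, ∑ j, g (ξ i j).1 (ξ i j).2 * (P.len i * Q.len j) - I| < ε

open Classical in
/-- The value of the Riemann delta integral over `[a, b) ∩ T` for `a ≤ b` (and `0` if the function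
is not integrable). -/
noncomputable def deltaIntegralAux (T : Set ℝ) (g : ℝ → ℝ) (a b : ℝ) : ℝ :=
  if h : ∃ I, HasDeltaIntegral T g a b I then h.choose else 0

open Classical in
/-- The delta integral `∫_a^b g(s) Δs` over the time scale `T`, with
`∫_a^b = - ∫_b^a` for `b < a`. -/
noncomputable def deltaIntegral (T : Set ℝ) (g : ℝ → ℝ) (a b : ℝ) : ℝ :=
  if a ≤ b then deltaIntegralAux T g a b else - deltaIntegralAux T g b a

open Classical in
/-- The double delta integral `∫_{a₁}^{b₁} ∫_{a₂}^{b₂} g(s₁, s₂) Δ₁s₁ Δ₂s₂` for `a₁ ≤ b₁` and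
`a₂ ≤ b₂` (and `0` if the function is not integrable). -/
noncomputable def deltaIntegral₂ (T₁ T₂ : Set ℝ) (g : ℝ → ℝ → ℝ) (a₁ b₁ a₂ b₂ : ℝ) : ℝ :=
  if h : ∃ I, HasDeltaIntegral₂ T₁ T₂ g a₁ b₁ a₂ b₂ I then h.choose else 0

open Classical in
/-- The cylinder transformation `ξ_h(z) = log (1 + h z) / h` for `h > 0` and `ξ_0(z) = z`, for real
`z` with `1 + h z > 0`. -/
noncomputable def cylinder (h z : ℝ) : ℝ :=
  if h = 0 then z else Real.log (1 + h * z) / h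

/-- The exponential function `e_p(t, s) = exp (∫_s^t ξ_{μ(τ)}(p(τ)) Δτ)` of the time scale `T`, for
real positively regressive `p`, that is, with `1 + μ p > 0`. -/
noncomputable def deltaExp (T : Set ℝ) (p : ℝ → ℝ) (t s : ℝ) : ℝ :=
  Real.exp (deltaIntegral T (fun τ => cylinder (graininess T τ) (p τ)) s t)

open MeasureTheory hiding cylinder
open Filter Topology Set

/-! Delta integrals become Lebesgue integrals: for the integrands met here, `∫_a^b g Δs` is the
integral of `g ∘ tsFloor T` over the real interval `[a, b)`, since a delta sum is the integral of a
step function and dominated convergence applies (`tendsto_sum_step`, `deltaIntegral_eq`,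
`deltaIntegral₂_eq`). Additivity, monotonicity and Fubini then come for free.

Fix `(t₁, t₂)` and set `A = a t₁ t₂`, `q s = ∫ f s · u s` over `[a₂, t₂)` and `z s = A + ∫_{a₁}^s
q`. Monotonicity of `a` and nonnegativity of `f u` give `u s t ≤ z s` for all `s ≤ t₁`, `t ≤ t₂`.
Hence `q ≤ p z`, and the claim reduces to Grönwall's inequality in one variable.

That inequality (`le_mul_exp_setIntegral_cylinder`) is proved along steps that are jumps or have
length at most `δ`. A jump multiplies `z` by at most `1 + μ p`, which is exactly the factor in the
exponential. A short step costs an extra `K δ (s' - s)` in the exponent. The total error `K δ (b -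
a)` vanishes as `δ → 0`. -/

/-- The largest point of the time scale `T` that is at most `x`. -/
noncomputable def tsFloor (T : Set ℝ) (x : ℝ) : ℝ := sSup (T ∩ Iic x)

/-! ### Floor, forward jump and induction along a time scale. -/

section Floor

variable {T : Set ℝ} {a b t x δ : ℝ}

theorem tsFloor_mem (hT : IsClosed T) (ha : a ∈ T) (hx : a ≤ x) : tsFloor T x ∈ T ∩ Iic x :=
  (hT.inter isClosed_Iic).csSup_mem ⟨a, ha, hx⟩ ⟨x, fun _ h => h.2⟩

theorem le_tsFloor (ha : a ∈ T) (hx : a ≤ x) : a ≤ tsFloor T x :=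
  le_csSup ⟨x, fun _ h => h.2⟩ ⟨ha, hx⟩

theorem tsFloor_mem_Ico (hT : IsClosed T) (ha : a ∈ T) (hx : x ∈ Ico a b) :
    tsFloor T x ∈ T ∩ Ico a b := by
  have h := tsFloor_mem hT ha hx.1
  exact ⟨h.1, le_tsFloor ha hx.1, lt_of_le_of_lt h.2 hx.2⟩

theorem forwardJump_le (hb : b ∈ T) (h : t < b) : forwardJump T t ≤ b := by
  unfold forwardJump
  rw [if_pos ⟨b, hb, h⟩]
  exact csInf_le ⟨t, fun _ h => le_of_lt h.2⟩ ⟨hb, h⟩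

theorem le_forwardJump (T : Set ℝ) (t : ℝ) : t ≤ forwardJump T t := by
  unfold forwardJump
  split_ifs with h
  · exact le_csInf h fun _ h => le_of_lt h.2
  · exact le_rfl

theorem graininess_nonneg (T : Set ℝ) (t : ℝ) : 0 ≤ graininess T t :=
  sub_nonneg.2 (le_forwardJump T t)

theorem forwardJump_mem (hT : IsClosed T) (ht : t ∈ T) : forwardJump T t ∈ T := by
  unfold forwardJump
  split_ifs with h
  · have h1 : sInf (T ∩ Ioi t) ∈ closure (T ∩ Ioi t) :=
      csInf_mem_closure h ⟨t, fun _ h => le_of_lt h.2⟩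
    exact hT.closure_subset (closure_mono inter_subset_left h1)
  · exact ht

theorem eq_of_mem_Ico_forwardJump {s : ℝ} (hs : s ∈ T) (h : s ∈ Ico t (forwardJump T t)) :
    s = t := by
  by_contra hne
  exact absurd (forwardJump_le hs (lt_of_le_of_ne h.1 (Ne.symm hne))) (not_le.2 h.2)

/-- Induction along a time scale by steps that are short or jumps. -/
theorem fine_step_induction (hT : IsClosed T) (hδ : 0 < δ) (ha : a ∈ T) {C : ℝ → Prop}
    (h0 : C a)
    (hstep : ∀ s ∈ T ∩ Icc a b, ∀ s' ∈ T ∩ Icc a b, s < s' →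
      (s' - s ≤ δ ∨ forwardJump T s = s') → C s → C s') :
    ∀ t ∈ T ∩ Icc a b, C t := by
  have key : ∀ n : ℕ, ∀ t ∈ T ∩ Icc a b, t ≤ a + n * δ → C t := by
    intro n
    induction n with
    | zero =>
      intro t ht h
      have : t = a := le_antisymm (by simpa using h) ht.2.1
      rwa [this]
    | succ n ih =>
      intro t ht h
      push_cast at h
      rcases le_or_gt t (a + n * δ) with h1 | h1
      · exact ih t ht h1
      have hax : a ≤ a + n * δ := by
        have : (0 : ℝ) ≤ n * δ := by positivity
        linarith
      -- Let `r` be the last point of `T` up to `a + n * δ`. If `t` is more than `δ` beyond `r`,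
      -- then `r` jumps past `a + n * δ`, and what remains from `forwardJump T r` to `t` is shorter
      -- than `δ`.
      have hr := tsFloor_mem hT ha hax
      have hra := le_tsFloor ha hax
      have hmax : ∀ s ∈ T, s ≤ a + n * δ → s ≤ tsFloor T (a + n * δ) :=
        fun s hs hs' => le_tsFloor hs hs'
      generalize tsFloor T (a + n * δ) = r at *
      have hr2 : r ≤ a + n * δ := hr.2
      have hrt : r < t := lt_of_le_of_lt hr2 h1
      have hrI : r ∈ T ∩ Icc a b := ⟨hr.1, hra, hrt.le.trans ht.2.2⟩
      have hCr := ih r hrI hr2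
      rcases le_or_gt (t - r) δ with h2 | h2
      · exact hstep r hrI t ht hrt (Or.inl h2) hCr
      have hσt := forwardJump_le ht.1 hrt
      have hσT := forwardJump_mem hT hr.1
      have hσr : r < forwardJump T r := by
        unfold forwardJump
        rw [if_pos ⟨t, ht.1, hrt⟩]
        refine lt_of_lt_of_le (b := a + n * δ) (by linarith) (le_csInf ⟨t, ht.1, hrt⟩ ?_)
        intro s hs
        by_contra hlt
        exact absurd (hmax s hs.1 (not_le.1 hlt).le) (not_le.2 hs.2)
      have hσn : a + n * δ < forwardJump T r := by
        by_contra hlt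
        exact absurd (hmax _ hσT (not_lt.1 hlt)) (not_le.2 hσr)
      have hσI : forwardJump T r ∈ T ∩ Icc a b :=
        ⟨hσT, hra.trans hσr.le, hσt.trans ht.2.2⟩
      have hCσ := hstep r hrI _ hσI hσr (Or.inr rfl) hCr
      rcases hσt.eq_or_lt with h3 | h3
      · rwa [← h3]
      · exact hstep _ hσI t ht h3 (Or.inl (by linarith)) hCσ
  intro t ht
  obtain ⟨n, hn⟩ := exists_nat_ge ((t - a) / δ)
  refine key n t ht ?_
  rw [div_le_iff₀ hδ] at hn
  linarith

end Floor

/-! ### Fine partitions and their real cells. -/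

namespace DeltaPartition

variable {T : Set ℝ} {a b δ x : ℝ}

/-- Extend a partition by one point on the right. -/
def extend (P : DeltaPartition T a b) (c : ℝ) (hc : c ∈ T) (h : b < c) : DeltaPartition T a c where
  n := P.n + 1
  pt := Fin.snoc (α := fun _ => ℝ) P.pt c
  strictMono := by
    rw [Fin.strictMono_iff_lt_succ]
    intro i
    induction i using Fin.lastCases with
    | last => simpa [P.last] using h
    | cast i =>
      rw [Fin.snoc_castSucc, Fin.succ_castSucc, Fin.snoc_castSucc]
      exact P.strictMono Fin.castSucc_lt_succ
  mem := by
    intro i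
    induction i using Fin.lastCases with
    | last => simpa using hc
    | cast i => simpa using P.mem i
  first := by
    have : (0 : Fin (P.n + 1 + 1)) = Fin.castSucc 0 := rfl
    rw [this, Fin.snoc_castSucc, P.first]
  last := by simp

theorem Fine.extend {P : DeltaPartition T a b} (hP : P.Fine δ) {c : ℝ} (hc : c ∈ T) (h : b < c)
    (hbc : c - b ≤ δ ∨ forwardJump T b = c) : (P.extend c hc h).Fine δ := by
  intro i
  induction i using Fin.lastCases with
  | last => simpa [DeltaPartition.extend, len, P.last] using hbc
  | cast i =>
    have := hP i
    unfold len at this ⊢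
    simp only [DeltaPartition.extend]
    rw [Fin.snoc_castSucc, Fin.succ_castSucc, Fin.snoc_castSucc]
    exact this

/-- Keeps the limit defining the integral from being vacuous, so that integrals are unique. -/
theorem exists_fine (hT : IsClosed T) (ha : a ∈ T) (hb : b ∈ T) (hab : a ≤ b) (hδ : 0 < δ) :
    ∃ P : DeltaPartition T a b, P.Fine δ := by
  refine fine_step_induction (b := b) (C := fun t => ∃ P : DeltaPartition T a t, P.Fine δ)
    hT hδ ha ?_ ?_ b ⟨hb, hab, le_rfl⟩
  · refine ⟨⟨0, fun _ => a, ?_, fun _ => ha, rfl, rfl⟩, fun i => i.elim0⟩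
    intro i j hij
    exact absurd hij (by simp [Fin.fin_one_eq_zero i, Fin.fin_one_eq_zero j])
  · rintro s hs s' hs' hlt h ⟨P, hP⟩
    exact ⟨P.extend s' hs'.1 hlt, hP.extend hs'.1 hlt h⟩

theorem exists_mem_Ico (P : DeltaPartition T a b) (hx : x ∈ Ico a b) :
    ∃ i : Fin P.n, x ∈ Ico (P.pt i.castSucc) (P.pt i.succ) := by
  have key : ∀ k : Fin (P.n + 1), x < P.pt k →
      ∃ i : Fin P.n, x ∈ Ico (P.pt i.castSucc) (P.pt i.succ) := by
    intro k
    induction k using Fin.induction with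
    | zero => intro h; rw [P.first] at h; exact absurd hx.1 (not_le.2 h)
    | succ i ih =>
      intro h
      rcases le_or_gt (P.pt i.castSucc) x with h1 | h1
      · exact ⟨i, h1, h⟩
      · exact ih h1
  exact key (Fin.last _) (by rw [P.last]; exact hx.2)

theorem Ico_subset (P : DeltaPartition T a b) (i : Fin P.n) :
    Ico (P.pt i.castSucc) (P.pt i.succ) ⊆ Ico a b := by
  exact Ico_subset_Ico (P.first.symm.le.trans (P.strictMono.monotone (Fin.zero_le _)))
    ((P.strictMono.monotone (Fin.le_last _)).trans P.last.le)

theorem cell_subset (P : DeltaPartition T a b) (i : Fin P.n) : P.cell i ⊆ T ∩ Ico a b :=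
  fun _ h => ⟨h.2, P.Ico_subset i h.1⟩

theorem eq_of_mem_Ico (P : DeltaPartition T a b) {i j : Fin P.n}
    (hi : x ∈ Ico (P.pt i.castSucc) (P.pt i.succ))
    (hj : x ∈ Ico (P.pt j.castSucc) (P.pt j.succ)) : i = j := by
  have h1 := P.strictMono.lt_iff_lt.1 (hi.1.trans_lt hj.2)
  have h2 := P.strictMono.lt_iff_lt.1 (hj.1.trans_lt hi.2)
  rw [Fin.castSucc_lt_succ_iff] at h1 h2
  exact le_antisymm h1 h2

theorem len_pos (P : DeltaPartition T a b) (i : Fin P.n) : 0 < P.len i :=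
  sub_pos.2 (P.strictMono Fin.castSucc_lt_succ)

theorem volume_real_Ico (P : DeltaPartition T a b) (i : Fin P.n) :
    volume.real (Ico (P.pt i.castSucc) (P.pt i.succ)) = P.len i := by
  rw [Real.volume_real_Ico_of_le (sub_nonneg.1 (P.len_pos i).le)]; rfl

theorem left_mem_cell (P : DeltaPartition T a b) (i : Fin P.n) : P.pt i.castSucc ∈ P.cell i :=
  ⟨⟨le_rfl, P.strictMono Fin.castSucc_lt_succ⟩, P.mem _⟩

theorem tsFloor_mem_cell (P : DeltaPartition T a b) (hT : IsClosed T) {i : Fin P.n}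
    (hx : x ∈ Ico (P.pt i.castSucc) (P.pt i.succ)) : tsFloor T x ∈ P.cell i := by
  have := tsFloor_mem_Ico hT (P.mem _) hx
  exact ⟨this.2, this.1⟩

/-- A tag and the floor of `x` share a cell, which is either short or a jump containing a single
point of `T`. The second clause makes continuity unnecessary at right-scattered points. -/
theorem Fine.abs_sub_tsFloor_le {P : DeltaPartition T a b} (hP : P.Fine δ) (hδ : 0 ≤ δ)
    (hT : IsClosed T) {i : Fin P.n}
    (hx : x ∈ Ico (P.pt i.castSucc) (P.pt i.succ)) {ξ : ℝ} (hξ : ξ ∈ P.cell i) :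
    |ξ - tsFloor T x| ≤ δ ∧ (δ < graininess T (tsFloor T x) → ξ = tsFloor T x) := by
  obtain ⟨hL, hLT⟩ := P.tsFloor_mem_cell hT hx
  rcases hP i with h | h
  · unfold len at h
    refine ⟨?_, fun hlt => ?_⟩
    · rw [abs_le]
      constructor <;> linarith [hξ.1.1, hξ.1.2, hL.1, hL.2]
    · have := forwardJump_le (P.mem i.succ) hL.2
      unfold graininess at hlt
      linarith [hL.1]
  · have : ξ = tsFloor T x := by
      rw [eq_of_mem_Ico_forwardJump hξ.2 (h ▸ hξ.1), eq_of_mem_Ico_forwardJump hLT (h ▸ hL)]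
    exact ⟨by simpa [this] using hδ, fun _ => this⟩

end DeltaPartition

/-- Dominated convergence for sums that are integrals of step functions. -/
theorem tendsto_sum_step {α : Type*} [MeasurableSpace α] {ν : Measure α} {S : Set α}
    (hS : MeasurableSet S) (hSfin : ν S ≠ ⊤) {ι : ℕ → Type*} [∀ n, Fintype (ι n)]
    {C : ∀ n, ι n → Set α} (hC : ∀ n i, MeasurableSet (C n i)) (hCS : ∀ n i, C n i ⊆ S)
    (hdisj : ∀ n i j x, x ∈ C n i → x ∈ C n j → i = j)
    (hcover : ∀ n, ∀ x ∈ S, ∃ i, x ∈ C n i)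
    {v : ∀ n, ι n → ℝ} {M : ℝ} (hv : ∀ n i, |v n i| ≤ M) {G : α → ℝ}
    (hG : ∀ x ∈ S, ∀ ε > 0, ∀ᶠ n in atTop, ∀ i, x ∈ C n i → |v n i - G x| < ε) :
    IntegrableOn G S ν ∧
      Tendsto (fun n => ∑ i, v n i * ν.real (C n i)) atTop (𝓝 (∫ x in S, G x ∂ν)) := by
  classical
  let h : ℕ → α → ℝ := fun n x => ∑ i, (C n i).indicator (fun _ => v n i) x
  have hval : ∀ n i x, x ∈ C n i → h n x = v n i := by
    intro n i x hx
    simp only [h]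
    rw [Finset.sum_eq_single i]
    · simp [hx]
    · intro j _ hj
      exact indicator_of_notMem (fun hxj => hj (hdisj n j i x hxj hx)) _
    · simp
  have hmeas : ∀ n, Measurable (h n) := fun n =>
    Finset.measurable_sum _ fun i _ => measurable_const.indicator (hC n i)
  have hlim : ∀ x ∈ S, Tendsto (fun n => h n x) atTop (𝓝 (G x)) := by
    intro x hx
    rw [Metric.tendsto_nhds]
    intro ε hε
    filter_upwards [hG x hx ε hε] with n hn
    obtain ⟨i, hi⟩ := hcover n x hx
    rw [hval n i x hi, Real.dist_eq]
    exact hn i hi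
  have hbd : ∀ n, ∀ x ∈ S, ‖h n x‖ ≤ M := by
    intro n x hx
    obtain ⟨i, hi⟩ := hcover n x hx
    rw [hval n i x hi]
    exact hv n i
  have hlim' : ∀ᵐ x ∂ν.restrict S, Tendsto (fun n => h n x) atTop (𝓝 (G x)) :=
    (ae_restrict_iff' hS).2 (Eventually.of_forall hlim)
  have : IsFiniteMeasure (ν.restrict S) := ⟨by simpa using hSfin.lt_top⟩
  -- Measurability of `G` is not assumed; it is inherited from the step functions.
  have hGm : AEStronglyMeasurable G (ν.restrict S) :=
    aestronglyMeasurable_of_tendsto_ae atTop (fun n => (hmeas n).aestronglyMeasurable) hlim'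
  constructor
  · refine Integrable.of_bound hGm M ((ae_restrict_iff' hS).2 (Eventually.of_forall ?_))
    intro x hx
    exact le_of_tendsto (hlim x hx).norm (Eventually.of_forall fun n => hbd n x hx)
  · have := tendsto_integral_of_dominated_convergence (μ := ν.restrict S) (F := h) (f := G)
      (fun _ => M) (fun n => (hmeas n).aestronglyMeasurable) (integrable_const _)
      (fun n => (ae_restrict_iff' hS).2 (Eventually.of_forall (hbd n))) hlim'
    refine this.congr fun n => ?_
    simp only [h]
    rw [integral_finsetSum]
    · refine Finset.sum_congr rfl fun i _ => ?_
      rw [integral_indicator (hC n i), Measure.restrict_restrict (hC n i),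
        inter_eq_left.2 (hCS n i)]
      simp [mul_comm]
    · intro i _
      exact (integrable_const _).indicator (hC n i)

/-! ### The delta integral as a Lebesgue integral. -/

section Integral

variable {T : Set ℝ} {a b : ℝ} {g : ℝ → ℝ}

/-- The step functions converge to `g ∘ tsFloor T` pointwise: at a right-scattered floor they are
eventually equal to it, elsewhere continuity is used. Continuity everywhere would be too much to
ask, because the graininess inside `cylinder` can be discontinuous at left-dense, right-scattered
points. -/
theorem tendsto_delta_sum (hT : IsClosed T) (ha : a ∈ T) {M : ℝ}
    (hM : ∀ t ∈ T ∩ Ico a b, |g t| ≤ M)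
    (hg : ∀ t ∈ T ∩ Ico a b, 0 < graininess T t ∨ ContinuousWithinAt g (T ∩ Ico a b) t)
    {δ : ℕ → ℝ} (hδ0 : ∀ n, 0 ≤ δ n) (hδ : Tendsto δ atTop (𝓝 0))
    (P : ℕ → DeltaPartition T a b) (hP : ∀ n, (P n).Fine (δ n))
    (ξ : ∀ n, Fin (P n).n → ℝ) (hξ : ∀ n i, ξ n i ∈ (P n).cell i) :
    IntegrableOn (fun x => g (tsFloor T x)) (Ico a b) ∧
    Tendsto (fun n => ∑ i, g (ξ n i) * (P n).len i) atTop
      (𝓝 (∫ x in Ico a b, g (tsFloor T x))) := by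
  have := tendsto_sum_step (ν := volume) (S := Ico a b) measurableSet_Ico (by simp)
    (C := fun n i => Ico ((P n).pt (Fin.castSucc i)) ((P n).pt (Fin.succ i)))
    (fun n i => measurableSet_Ico) (fun n i => (P n).Ico_subset i)
    (fun n i j x => (P n).eq_of_mem_Ico) (fun n x hx => (P n).exists_mem_Ico hx)
    (v := fun n i => g (ξ n i)) (fun n i => hM _ ((P n).cell_subset i (hξ n i)))
    (G := fun x => g (tsFloor T x)) ?_
  · simpa only [DeltaPartition.volume_real_Ico] using this
  · intro x hx ε hε
    have hL := tsFloor_mem_Ico hT ha hx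
    rcases hg _ hL with h | h
    · filter_upwards [hδ.eventually_lt_const h] with n hn i hi
      rw [((hP n).abs_sub_tsFloor_le (hδ0 n) hT hi (hξ n i)).2 hn]
      simpa using hε
    · obtain ⟨η, hη, hc⟩ := Metric.continuousWithinAt_iff.1 h ε hε
      filter_upwards [hδ.eventually_lt_const hη] with n hn i hi
      have := ((hP n).abs_sub_tsFloor_le (hδ0 n) hT hi (hξ n i)).1
      exact hc ((P n).cell_subset i (hξ n i)) (this.trans_lt hn)

theorem integrableOn_comp_tsFloor (hT : IsClosed T) (ha : a ∈ T) (hb : b ∈ T) (hab : a ≤ b)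
    {M : ℝ} (hM : ∀ t ∈ T ∩ Ico a b, |g t| ≤ M)
    (hg : ∀ t ∈ T ∩ Ico a b, 0 < graininess T t ∨ ContinuousWithinAt g (T ∩ Ico a b) t) :
    IntegrableOn (fun x => g (tsFloor T x)) (Ico a b) := by
  choose P hP using fun n : ℕ =>
    DeltaPartition.exists_fine hT ha hb hab (Nat.one_div_pos_of_nat (α := ℝ) (n := n))
  exact (tendsto_delta_sum hT ha hM hg (fun n => Nat.one_div_pos_of_nat.le)
    tendsto_one_div_add_atTop_nhds_zero_nat P hP _ fun n i => (P n).left_mem_cell i).1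

theorem hasDeltaIntegral_setIntegral (hT : IsClosed T) (ha : a ∈ T)
    {M : ℝ} (hM : ∀ t ∈ T ∩ Ico a b, |g t| ≤ M)
    (hg : ∀ t ∈ T ∩ Ico a b, 0 < graininess T t ∨ ContinuousWithinAt g (T ∩ Ico a b) t) :
    HasDeltaIntegral T g a b (∫ x in Ico a b, g (tsFloor T x)) := by
  intro ε hε
  -- Failure of uniformity would yield bad tagged partitions with mesh `1 / (n + 1)`, contradicting
  -- the sequential limit.
  by_contra! hcon
  choose P hP ξ hξ hbad using fun n : ℕ => hcon _ (Nat.one_div_pos_of_nat (α := ℝ) (n := n))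
  have := (tendsto_delta_sum hT ha hM hg (fun n => Nat.one_div_pos_of_nat.le)
    tendsto_one_div_add_atTop_nhds_zero_nat P hP ξ hξ).2
  obtain ⟨n, hn⟩ := ((Metric.tendsto_nhds.1 this) ε hε).exists
  rw [Real.dist_eq] at hn
  exact absurd hn (not_lt.2 (hbad n))

theorem HasDeltaIntegral.unique (hT : IsClosed T) (ha : a ∈ T) (hb : b ∈ T) (hab : a ≤ b)
    {I J : ℝ} (hI : HasDeltaIntegral T g a b I) (hJ : HasDeltaIntegral T g a b J) : I = J := by
  by_contra hne
  have hε : 0 < |I - J| / 2 := by have := abs_pos.2 (sub_ne_zero.2 hne); positivity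
  obtain ⟨δ, hδ, h1⟩ := hI _ hε
  obtain ⟨δ', hδ', h2⟩ := hJ _ hε
  obtain ⟨P, hP⟩ := DeltaPartition.exists_fine hT ha hb hab (lt_min hδ hδ')
  have e1 := h1 P (fun i => (hP i).imp (fun h => h.trans (min_le_left _ _)) id) _ P.left_mem_cell
  have e2 := h2 P (fun i => (hP i).imp (fun h => h.trans (min_le_right _ _)) id) _ P.left_mem_cell
  rw [abs_sub_comm] at e1
  have := abs_sub_le I (∑ i, g (P.pt i.castSucc) * P.len i) J
  linarith

theorem deltaIntegral_eq (hT : IsClosed T) (ha : a ∈ T) (hb : b ∈ T) (hab : a ≤ b)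
    {M : ℝ} (hM : ∀ t ∈ T ∩ Ico a b, |g t| ≤ M)
    (hg : ∀ t ∈ T ∩ Ico a b, 0 < graininess T t ∨ ContinuousWithinAt g (T ∩ Ico a b) t) :
    deltaIntegral T g a b = ∫ x in Ico a b, g (tsFloor T x) := by
  have h : ∃ I, HasDeltaIntegral T g a b I := ⟨_, hasDeltaIntegral_setIntegral hT ha hM hg⟩
  rw [deltaIntegral, if_pos hab, deltaIntegralAux, dif_pos h]
  exact h.choose_spec.unique hT ha hb hab (hasDeltaIntegral_setIntegral hT ha hM hg)

end Integral

/-! ### The double delta integral as a Lebesgue integral. -/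

section Integral₂

variable {T₁ T₂ : Set ℝ} {a₁ b₁ a₂ b₂ : ℝ} {g : ℝ → ℝ → ℝ}

theorem tendsto_delta_sum₂ (hT₁ : IsClosed T₁) (hT₂ : IsClosed T₂) (ha₁ : a₁ ∈ T₁) (ha₂ : a₂ ∈ T₂)
    {M : ℝ} (hM : ∀ s ∈ T₁ ∩ Ico a₁ b₁, ∀ t ∈ T₂ ∩ Ico a₂ b₂, |g s t| ≤ M)
    (hg : ContinuousOn (fun x : ℝ × ℝ => g x.1 x.2) ((T₁ ∩ Ico a₁ b₁) ×ˢ (T₂ ∩ Ico a₂ b₂)))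
    {δ : ℕ → ℝ} (hδ0 : ∀ n, 0 ≤ δ n) (hδ : Tendsto δ atTop (𝓝 0))
    (P : ℕ → DeltaPartition T₁ a₁ b₁) (hP : ∀ n, (P n).Fine (δ n))
    (Q : ℕ → DeltaPartition T₂ a₂ b₂) (hQ : ∀ n, (Q n).Fine (δ n))
    (ξ : ∀ n, Fin (P n).n → Fin (Q n).n → ℝ × ℝ)
    (hξ : ∀ n i j, ξ n i j ∈ (P n).cell i ×ˢ (Q n).cell j) :
    IntegrableOn (fun x : ℝ × ℝ => g (tsFloor T₁ x.1) (tsFloor T₂ x.2))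
      (Ico a₁ b₁ ×ˢ Ico a₂ b₂) ∧
    Tendsto (fun n => ∑ i, ∑ j, g (ξ n i j).1 (ξ n i j).2 * ((P n).len i * (Q n).len j)) atTop
      (𝓝 (∫ x in Ico a₁ b₁ ×ˢ Ico a₂ b₂, g (tsFloor T₁ x.1) (tsFloor T₂ x.2))) := by
  have := tendsto_sum_step (ν := (volume : Measure (ℝ × ℝ))) (S := Ico a₁ b₁ ×ˢ Ico a₂ b₂)
    (measurableSet_Ico.prod measurableSet_Ico)
    (by rw [Measure.volume_eq_prod, Measure.prod_prod]; simp [ENNReal.mul_eq_top])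
    (ι := fun n => Fin (P n).n × Fin (Q n).n)
    (C := fun n i => Ico ((P n).pt (Fin.castSucc i.1)) ((P n).pt (Fin.succ i.1)) ×ˢ
      Ico ((Q n).pt (Fin.castSucc i.2)) ((Q n).pt (Fin.succ i.2)))
    (fun n i => measurableSet_Ico.prod measurableSet_Ico)
    (fun n i => prod_mono ((P n).Ico_subset i.1) ((Q n).Ico_subset i.2))
    (fun n i j x hi hj => Prod.ext ((P n).eq_of_mem_Ico hi.1 hj.1) ((Q n).eq_of_mem_Ico hi.2 hj.2))
    (fun n x hx => by
      obtain ⟨i, hi⟩ := (P n).exists_mem_Ico hx.1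
      obtain ⟨j, hj⟩ := (Q n).exists_mem_Ico hx.2
      exact ⟨(i, j), hi, hj⟩)
    (v := fun n i => g (ξ n i.1 i.2).1 (ξ n i.1 i.2).2)
    (fun n i => hM _ ((P n).cell_subset i.1 (hξ n i.1 i.2).1) _
      ((Q n).cell_subset i.2 (hξ n i.1 i.2).2))
    (G := fun x => g (tsFloor T₁ x.1) (tsFloor T₂ x.2)) ?_
  · simpa only [Measure.volume_eq_prod, measureReal_prod_prod, DeltaPartition.volume_real_Ico,
      Fintype.sum_prod_type] using this
  · intro x hx ε hε
    have hL₁ := tsFloor_mem_Ico hT₁ ha₁ hx.1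
    have hL₂ := tsFloor_mem_Ico hT₂ ha₂ hx.2
    obtain ⟨η, hη, hc⟩ := Metric.continuousWithinAt_iff.1
      (hg (tsFloor T₁ x.1, tsFloor T₂ x.2) ⟨hL₁, hL₂⟩) ε hε
    filter_upwards [hδ.eventually_lt_const hη] with n hn i hi
    have h1 := ((hP n).abs_sub_tsFloor_le (hδ0 n) hT₁ hi.1 (hξ n i.1 i.2).1).1
    have h2 := ((hQ n).abs_sub_tsFloor_le (hδ0 n) hT₂ hi.2 (hξ n i.1 i.2).2).1
    refine hc ⟨(P n).cell_subset i.1 (hξ n i.1 i.2).1, (Q n).cell_subset i.2 (hξ n i.1 i.2).2⟩ ?_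
    rw [Prod.dist_eq]
    exact max_lt (h1.trans_lt hn) (h2.trans_lt hn)

theorem integrableOn_comp_tsFloor₂ (hT₁ : IsClosed T₁) (hT₂ : IsClosed T₂)
    (ha₁ : a₁ ∈ T₁) (ha₂ : a₂ ∈ T₂) (hb₁ : b₁ ∈ T₁) (hb₂ : b₂ ∈ T₂) (h₁ : a₁ ≤ b₁) (h₂ : a₂ ≤ b₂)
    {M : ℝ} (hM : ∀ s ∈ T₁ ∩ Ico a₁ b₁, ∀ t ∈ T₂ ∩ Ico a₂ b₂, |g s t| ≤ M)
    (hg : ContinuousOn (fun x : ℝ × ℝ => g x.1 x.2) ((T₁ ∩ Ico a₁ b₁) ×ˢ (T₂ ∩ Ico a₂ b₂))) :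
    IntegrableOn (fun x : ℝ × ℝ => g (tsFloor T₁ x.1) (tsFloor T₂ x.2))
      (Ico a₁ b₁ ×ˢ Ico a₂ b₂) := by
  choose P hP using fun n : ℕ =>
    DeltaPartition.exists_fine hT₁ ha₁ hb₁ h₁ (Nat.one_div_pos_of_nat (α := ℝ) (n := n))
  choose Q hQ using fun n : ℕ =>
    DeltaPartition.exists_fine hT₂ ha₂ hb₂ h₂ (Nat.one_div_pos_of_nat (α := ℝ) (n := n))
  exact (tendsto_delta_sum₂ hT₁ hT₂ ha₁ ha₂ hM hg (fun n => Nat.one_div_pos_of_nat.le)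
    tendsto_one_div_add_atTop_nhds_zero_nat P hP Q hQ (fun n i j => (_, _))
    fun n i j => ⟨(P n).left_mem_cell i, (Q n).left_mem_cell j⟩).1

theorem hasDeltaIntegral₂_setIntegral (hT₁ : IsClosed T₁) (hT₂ : IsClosed T₂)
    (ha₁ : a₁ ∈ T₁) (ha₂ : a₂ ∈ T₂)
    {M : ℝ} (hM : ∀ s ∈ T₁ ∩ Ico a₁ b₁, ∀ t ∈ T₂ ∩ Ico a₂ b₂, |g s t| ≤ M)
    (hg : ContinuousOn (fun x : ℝ × ℝ => g x.1 x.2) ((T₁ ∩ Ico a₁ b₁) ×ˢ (T₂ ∩ Ico a₂ b₂))) :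
    HasDeltaIntegral₂ T₁ T₂ g a₁ b₁ a₂ b₂
      (∫ x in Ico a₁ b₁ ×ˢ Ico a₂ b₂, g (tsFloor T₁ x.1) (tsFloor T₂ x.2)) := by
  intro ε hε
  by_contra! hcon
  choose P Q hP hQ ξ hξ hbad using fun n : ℕ => hcon _ (Nat.one_div_pos_of_nat (α := ℝ) (n := n))
  have := (tendsto_delta_sum₂ hT₁ hT₂ ha₁ ha₂ hM hg (fun n => Nat.one_div_pos_of_nat.le)
    tendsto_one_div_add_atTop_nhds_zero_nat P hP Q hQ ξ hξ).2
  obtain ⟨n, hn⟩ := ((Metric.tendsto_nhds.1 this) ε hε).exists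
  rw [Real.dist_eq] at hn
  exact absurd hn (not_lt.2 (hbad n))

theorem HasDeltaIntegral₂.unique (hT₁ : IsClosed T₁) (hT₂ : IsClosed T₂)
    (ha₁ : a₁ ∈ T₁) (ha₂ : a₂ ∈ T₂) (hb₁ : b₁ ∈ T₁) (hb₂ : b₂ ∈ T₂) (h₁ : a₁ ≤ b₁) (h₂ : a₂ ≤ b₂)
    {I J : ℝ} (hI : HasDeltaIntegral₂ T₁ T₂ g a₁ b₁ a₂ b₂ I)
    (hJ : HasDeltaIntegral₂ T₁ T₂ g a₁ b₁ a₂ b₂ J) : I = J := by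
  by_contra hne
  have hε : 0 < |I - J| / 2 := by have := abs_pos.2 (sub_ne_zero.2 hne); positivity
  obtain ⟨δ, hδ, h1⟩ := hI _ hε
  obtain ⟨δ', hδ', h2⟩ := hJ _ hε
  obtain ⟨P, hP⟩ := DeltaPartition.exists_fine hT₁ ha₁ hb₁ h₁ (lt_min hδ hδ')
  obtain ⟨Q, hQ⟩ := DeltaPartition.exists_fine hT₂ ha₂ hb₂ h₂ (lt_min hδ hδ')
  have e1 := h1 P Q (fun i => (hP i).imp (fun h => h.trans (min_le_left _ _)) id)
    (fun i => (hQ i).imp (fun h => h.trans (min_le_left _ _)) id) (fun i j => (_, _))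
    fun i j => ⟨P.left_mem_cell i, Q.left_mem_cell j⟩
  have e2 := h2 P Q (fun i => (hP i).imp (fun h => h.trans (min_le_right _ _)) id)
    (fun i => (hQ i).imp (fun h => h.trans (min_le_right _ _)) id) (fun i j => (_, _))
    fun i j => ⟨P.left_mem_cell i, Q.left_mem_cell j⟩
  rw [abs_sub_comm] at e1
  have := abs_sub_le I (∑ i, ∑ j, g (P.pt (Fin.castSucc i)) (Q.pt (Fin.castSucc j)) *
    (P.len i * Q.len j)) J
  linarith

theorem deltaIntegral₂_eq (hT₁ : IsClosed T₁) (hT₂ : IsClosed T₂)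
    (ha₁ : a₁ ∈ T₁) (ha₂ : a₂ ∈ T₂) (hb₁ : b₁ ∈ T₁) (hb₂ : b₂ ∈ T₂) (h₁ : a₁ ≤ b₁) (h₂ : a₂ ≤ b₂)
    {M : ℝ} (hM : ∀ s ∈ T₁ ∩ Ico a₁ b₁, ∀ t ∈ T₂ ∩ Ico a₂ b₂, |g s t| ≤ M)
    (hg : ContinuousOn (fun x : ℝ × ℝ => g x.1 x.2) ((T₁ ∩ Ico a₁ b₁) ×ˢ (T₂ ∩ Ico a₂ b₂))) :
    deltaIntegral₂ T₁ T₂ g a₁ b₁ a₂ b₂ =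
      ∫ x in Ico a₁ b₁ ×ˢ Ico a₂ b₂, g (tsFloor T₁ x.1) (tsFloor T₂ x.2) := by
  have hI := hasDeltaIntegral₂_setIntegral hT₁ hT₂ ha₁ ha₂ hM hg
  have h : ∃ I, HasDeltaIntegral₂ T₁ T₂ g a₁ b₁ a₂ b₂ I := ⟨_, hI⟩
  rw [deltaIntegral₂, dif_pos h]
  exact h.choose_spec.unique hT₁ hT₂ ha₁ ha₂ hb₁ hb₂ h₁ h₂ hI

end Integral₂

/-! ### Cylinder estimates and Grönwall's inequality in one variable. -/

section Gronwall

theorem cylinder_le {h z : ℝ} (hh : 0 ≤ h) (hz : 0 ≤ z) : cylinder h z ≤ z := by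
  unfold cylinder
  split_ifs with h0
  · exact le_rfl
  · have hpos : 0 < h := lt_of_le_of_ne hh (Ne.symm h0)
    rw [div_le_iff₀ hpos]
    have := Real.log_le_sub_one_of_pos (x := 1 + h * z) (by positivity)
    linarith

/-- From `log y ≥ 1 - 1 / y` and `1 / (1 + x) ≤ 1 - x + x ^ 2`. The quadratic loss is small wherever
the graininess is. -/
theorem le_cylinder {h z : ℝ} (hh : 0 ≤ h) (hz : 0 ≤ z) : z - h * z ^ 2 ≤ cylinder h z := by
  unfold cylinder
  split_ifs with h0
  · simp [h0]
  · have hpos : 0 < h := lt_of_le_of_ne hh (Ne.symm h0)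
    rw [le_div_iff₀ hpos]
    have h1 : 0 < 1 + h * z := by positivity
    have h2 := Real.one_sub_inv_le_log_of_pos h1
    have h3 : (1 + h * z)⁻¹ ≤ 1 - h * z + (h * z) ^ 2 := by
      rw [inv_le_iff_one_le_mul₀ h1]
      have : 0 ≤ (h * z) ^ 3 := by positivity
      nlinarith
    nlinarith

theorem cylinder_nonneg {h z : ℝ} (hh : 0 ≤ h) (hz : 0 ≤ z) : 0 ≤ cylinder h z := by
  unfold cylinder
  split_ifs
  · exact hz
  · exact div_nonneg (Real.log_nonneg (by nlinarith [mul_nonneg hh hz])) hh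

theorem mul_cylinder {h z : ℝ} (h0 : h ≠ 0) : h * cylinder h z = Real.log (1 + h * z) := by
  unfold cylinder
  rw [if_neg h0]
  field_simp

/-- Bounding `exp` below by its tangent leaves `(1 - k) (1 + k + 2 k²) = 1 + k² (1 - 2 k)`. Used to
solve `z s' * (1 - k) ≤ z s` for `z s'`. -/
theorem one_le_one_sub_mul_exp {k : ℝ} (hk : k ≤ 1 / 2) :
    1 ≤ (1 - k) * Real.exp (k + 2 * k ^ 2) := by
  have h1 := Real.add_one_le_exp (k + 2 * k ^ 2)
  have h2 : (1 - k) * (k + 2 * k ^ 2 + 1) ≤ (1 - k) * Real.exp (k + 2 * k ^ 2) :=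
    mul_le_mul_of_nonneg_left h1 (by linarith)
  nlinarith [mul_nonneg (sq_nonneg k) (by linarith : 0 ≤ 1 - 2 * k)]

variable {T : Set ℝ} {a b : ℝ}

/-- Left of a right-dense `t`, jumps cannot pass `t`; right of `t`, they cannot pass a point `s'` of
`T` chosen close to `t`. -/
theorem continuousWithinAt_graininess (hb : b ∈ T) {t : ℝ} (htT : t ∈ T) (ht : t ∈ Ico a b)
    (h0 : graininess T t = 0) : ContinuousWithinAt (graininess T) (T ∩ Ico a b) t := by
  rw [Metric.continuousWithinAt_iff]
  intro ε hε
  have hne : (T ∩ Ioi t).Nonempty := ⟨b, hb, ht.2⟩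
  have hinf : sInf (T ∩ Ioi t) < t + ε := by
    rw [graininess, forwardJump, if_pos hne] at h0
    linarith
  obtain ⟨s', hs', hlt⟩ := exists_lt_of_csInf_lt hne hinf
  have hts : t < s' := hs'.2
  refine ⟨min ε (s' - t), lt_min hε (by linarith), fun {s} hs hd => ?_⟩
  rw [Real.dist_eq, lt_min_iff, abs_lt, abs_lt] at hd
  rw [h0, Real.dist_eq, sub_zero, abs_of_nonneg (graininess_nonneg T s), graininess]
  rcases lt_or_ge s t with h | h
  · have := forwardJump_le htT h
    linarith [hd.1.1]
  · have := forwardJump_le hs'.1 (show s < s' by linarith [hd.2.2])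
    linarith

/-- Squeezed between `p - μ p ^ 2` and `p`, which agree where `μ = 0`. -/
theorem continuousWithinAt_cylinder (hb : b ∈ T) {p : ℝ → ℝ}
    (hp0 : ∀ t ∈ T ∩ Ico a b, 0 ≤ p t) {t : ℝ} (ht : t ∈ T ∩ Ico a b)
    (hp : ContinuousWithinAt p (T ∩ Ico a b) t) (h0 : graininess T t = 0) :
    ContinuousWithinAt (fun t => cylinder (graininess T t) (p t)) (T ∩ Ico a b) t := by
  have hμ := continuousWithinAt_graininess hb ht.1 ht.2 h0
  have hlow : ContinuousWithinAt (fun t => p t - graininess T t * p t ^ 2) (T ∩ Ico a b) t :=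
    hp.sub (hμ.mul (hp.pow 2))
  have hc : cylinder (graininess T t) (p t) = p t := by rw [h0, cylinder, if_pos rfl]
  unfold ContinuousWithinAt at *
  simp only [h0, zero_mul, sub_zero] at hlow
  beta_reduce
  rw [hc]
  refine tendsto_of_tendsto_of_tendsto_of_le_of_le' hlow hp ?_ ?_
  · filter_upwards [self_mem_nhdsWithin] with s hs
    exact le_cylinder (graininess_nonneg T s) (hp0 s hs)
  · filter_upwards [self_mem_nhdsWithin] with s hs
    exact cylinder_le (graininess_nonneg T s) (hp0 s hs)

theorem setIntegral_Ico_add {F : ℝ → ℝ} (hF : IntegrableOn F (Ico a b)) {s s' : ℝ} (has : a ≤ s)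
    (hss : s ≤ s') (hsb : s' ≤ b) :
    ∫ x in Ico a s', F x = (∫ x in Ico a s, F x) + ∫ x in Ico s s', F x := by
  rw [← Ico_union_Ico_eq_Ico has hss]
  refine setIntegral_union ?_ measurableSet_Ico (hF.mono_set ?_) (hF.mono_set ?_)
  · rw [Set.disjoint_left]
    exact fun x hx hx' => absurd hx.2 (not_lt.2 hx'.1)
  · exact Ico_subset_Ico le_rfl (hss.trans hsb)
  · exact Ico_subset_Ico has hsb

/-- Grönwall's inequality on a time scale, with delta integrals written as Lebesgue integrals. -/
theorem le_mul_exp_setIntegral_cylinder (hT : IsClosed T) (ha : a ∈ T) (hb : b ∈ T) (hab : a ≤ b)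
    {p q z : ℝ → ℝ} {A M : ℝ} (hA : 0 ≤ A) (hM0 : 0 ≤ M)
    (hp0 : ∀ t ∈ T ∩ Ico a b, 0 ≤ p t) (hpM : ∀ t ∈ T ∩ Ico a b, p t ≤ M)
    (hc : IntegrableOn (fun x => cylinder (graininess T (tsFloor T x)) (p (tsFloor T x)))
      (Ico a b))
    (hq : IntegrableOn (fun x => q (tsFloor T x)) (Ico a b))
    (hq0 : ∀ t ∈ T ∩ Ico a b, 0 ≤ q t)
    (hz : ∀ t ∈ T ∩ Icc a b, z t = A + ∫ x in Ico a t, q (tsFloor T x))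
    (hqz : ∀ t ∈ T ∩ Ico a b, q t ≤ p t * z t) :
    z b ≤ A * Real.exp
      (∫ x in Ico a b, cylinder (graininess T (tsFloor T x)) (p (tsFloor T x))) := by
  set c : ℝ → ℝ := fun t => cylinder (graininess T t) (p t) with hcdef
  change IntegrableOn (fun x => c (tsFloor T x)) (Ico a b) at hc
  change z b ≤ A * Real.exp (∫ x in Ico a b, c (tsFloor T x))
  have hfloor : ∀ x ∈ Ico a b, tsFloor T x ∈ T ∩ Ico a b := fun x hx => tsFloor_mem_Ico hT ha hx
  have hstepz : ∀ s ∈ T ∩ Icc a b, ∀ s' ∈ T ∩ Icc a b, s ≤ s' →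
      z s' = z s + ∫ x in Ico s s', q (tsFloor T x) := by
    intro s hs s' hs' hss
    rw [hz s hs, hz s' hs', setIntegral_Ico_add hq hs.2.1 hss hs'.2.2]
    ring
  have hsub : ∀ s ∈ T ∩ Icc a b, ∀ s' ∈ T ∩ Icc a b, Ico s s' ⊆ Ico a b :=
    fun s hs s' hs' => Ico_subset_Ico hs.2.1 hs'.2.2
  have hmono : ∀ s ∈ T ∩ Icc a b, ∀ s' ∈ T ∩ Icc a b, s ≤ s' → z s ≤ z s' := by
    intro s hs s' hs' hss
    rw [hstepz s hs s' hs' hss]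
    have : 0 ≤ ∫ x in Ico s s', q (tsFloor T x) :=
      setIntegral_nonneg measurableSet_Ico fun x hx => hq0 _ (hfloor x (hsub s hs s' hs' hx))
    linarith
  have haI : a ∈ T ∩ Icc a b := ⟨ha, le_rfl, hab⟩
  have hza : z a = A := by simp [hz a haI]
  have hz0 : ∀ s ∈ T ∩ Icc a b, 0 ≤ z s := fun s hs =>
    hA.trans (hza.symm.le.trans (hmono a haI s hs hs.2.1))
  -- `M ^ 2` pays for replacing `p` by `c` on a short step, `2 * (M + 1) ^ 2` for the term `2 * k ^
  -- 2`.
  set K : ℝ := M ^ 2 + 2 * (M + 1) ^ 2 with hK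
  have hK0 : 0 ≤ K := by positivity
  have key : ∀ δ > 0, δ * (M + 1) ^ 2 ≤ 1 / 2 →
      z b ≤ A * Real.exp ((∫ x in Ico a b, c (tsFloor T x)) + K * δ * (b - a)) := by
    intro δ hδ hδM
    refine fine_step_induction (b := b)
      (C := fun t => z t ≤ A * Real.exp ((∫ x in Ico a t, c (tsFloor T x)) + K * δ * (t - a)))
      hT hδ ha (by simp [hza]) ?_ b ⟨hb, hab, le_rfl⟩
    intro s hs s' hs' hlt hcase ih
    suffices hexp : z s' ≤ z s * Real.exp ((∫ x in Ico s s', c (tsFloor T x)) +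
        K * δ * (s' - s)) by
      refine hexp.trans ((mul_le_mul_of_nonneg_right ih (Real.exp_pos _).le).trans_eq ?_)
      rw [mul_assoc, ← Real.exp_add, setIntegral_Ico_add hc hs.2.1 hlt.le hs'.2.2]
      congr 2
      ring
    have hsI : s ∈ T ∩ Ico a b := ⟨hs.1, hs.2.1, hlt.trans_le hs'.2.2⟩
    have hlen : 0 < s' - s := by linarith
    -- On a jump the floor is constantly `s`, so both integrals are explicit and the error term is
    -- pure slack.
    by_cases hjump : forwardJump T s = s'
    · have hfl : ∀ x ∈ Ico s s', tsFloor T x = s := by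
        intro x hx
        have := tsFloor_mem_Ico hT hs.1 hx
        exact eq_of_mem_Ico_forwardJump this.1 (hjump ▸ this.2)
      have hμ : graininess T s = s' - s := by rw [graininess, hjump]
      have hconst : ∀ g : ℝ → ℝ, ∫ x in Ico s s', g (tsFloor T x) = (s' - s) * g s := by
        intro g
        rw [setIntegral_congr_fun measurableSet_Ico (g := fun _ => g s)
          (fun x hx => by simp only [hfl x hx])]
        simp [Real.volume_real_Ico_of_le hlt.le]
      have h1 : (s' - s) * c s = Real.log (1 + (s' - s) * p s) := by
        simp only [hcdef, hμ]
        exact mul_cylinder hlen.ne'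
      have h2 : 0 < 1 + (s' - s) * p s := by
        have := mul_nonneg hlen.le (hp0 s hsI)
        linarith
      rw [hstepz s hs s' hs' hlt.le, hconst q, hconst c, h1, Real.exp_add, Real.exp_log h2]
      have h3 : z s + (s' - s) * q s ≤ z s * (1 + (s' - s) * p s) := by
        nlinarith [mul_le_mul_of_nonneg_left (hqz s hsI) hlen.le]
      refine h3.trans ?_
      rw [← mul_assoc]
      refine le_mul_of_one_le_right (mul_nonneg (hz0 s hs) h2.le) (Real.one_le_exp ?_)
      positivity
    · have hshort : s' - s ≤ δ := hcase.resolve_right hjump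
      have hfl : ∀ x ∈ Ico s s', tsFloor T x ∈ T ∩ Ico s s' := fun x hx =>
        tsFloor_mem_Ico hT hs.1 hx
      have hfl' : ∀ x ∈ Ico s s', tsFloor T x ∈ T ∩ Ico a b := fun x hx =>
        hfloor x (hsub s hs s' hs' hx)
      have hcint := hc.mono_set (hsub s hs s' hs')
      have hvol : volume.real (Ico s s') = s' - s := Real.volume_real_Ico_of_le hlt.le
      have hconst : ∀ r : ℝ, IntegrableOn (fun _ : ℝ => r) (Ico s s') := fun r =>
        integrableOn_const (by simp)
      have hc0 : 0 ≤ ∫ x in Ico s s', c (tsFloor T x) :=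
        setIntegral_nonneg measurableSet_Ico fun x hx =>
          cylinder_nonneg (graininess_nonneg T _) (hp0 _ (hfl' x hx))
      have hcM : ∫ x in Ico s s', c (tsFloor T x) ≤ M * (s' - s) := by
        refine (setIntegral_mono_on hcint (hconst M) measurableSet_Ico fun x hx =>
          (cylinder_le (graininess_nonneg T _) (hp0 _ (hfl' x hx))).trans
            (hpM _ (hfl' x hx))).trans_eq ?_
        simp [hvol, mul_comm]
      -- Monotonicity bounds `z` by its value at the right end, so the resulting inequality is
      -- implicit in `z s'`.
      have hqle : ∫ x in Ico s s', q (tsFloor T x) ≤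
          ((∫ x in Ico s s', c (tsFloor T x)) + δ * M ^ 2 * (s' - s)) * z s' := by
        have hint : IntegrableOn (fun x => (c (tsFloor T x) + δ * M ^ 2) * z s') (Ico s s') :=
          (hcint.add (hconst _)).mul_const _
        refine (setIntegral_mono_on (hq.mono_set (hsub s hs s' hs')) hint measurableSet_Ico
          fun x hx => ?_).trans_eq ?_
        · have ht := hfl x hx
          have ht' := hfl' x hx
          have hμ : graininess T (tsFloor T x) ≤ δ := by
            have := forwardJump_le hs'.1 ht.2.2
            unfold graininess
            linarith [ht.2.1]
          have h1 := le_cylinder (graininess_nonneg T (tsFloor T x)) (hp0 _ ht')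
          have h2 : graininess T (tsFloor T x) * p (tsFloor T x) ^ 2 ≤ δ * M ^ 2 :=
            mul_le_mul hμ (pow_le_pow_left₀ (hp0 _ ht') (hpM _ ht') 2) (sq_nonneg _) hδ.le
          have h3 : p (tsFloor T x) ≤ c (tsFloor T x) + δ * M ^ 2 := by
            simp only [hcdef]
            linarith
          have htI : tsFloor T x ∈ T ∩ Icc a b := ⟨ht.1, Ico_subset_Icc_self ht'.2⟩
          exact (hqz _ ht').trans (mul_le_mul h3 (hmono _ htI _ hs' ht.2.2.le) (hz0 _ htI)
            ((hp0 _ ht').trans h3))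
        · rw [integral_mul_const, integral_add hcint (hconst _)]
          simp [hvol, mul_comm]
      set I := ∫ x in Ico s s', c (tsFloor T x)
      set k := I + δ * M ^ 2 * (s' - s) with hk
      have hk0 : 0 ≤ k := by positivity
      have hδM' : δ * M ^ 2 ≤ 1 := by nlinarith
      have hkM : k ≤ (M + 1) * (s' - s) := by nlinarith
      have hk2 : k ^ 2 ≤ (M + 1) ^ 2 * δ * (s' - s) := by
        calc k ^ 2 ≤ ((M + 1) * (s' - s)) ^ 2 := pow_le_pow_left₀ hk0 hkM 2
          _ = (M + 1) ^ 2 * (s' - s) * (s' - s) := by ring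
          _ ≤ (M + 1) ^ 2 * δ * (s' - s) := by gcongr
      have hkhalf : k ≤ 1 / 2 := by
        have h1 : (M + 1) * (s' - s) ≤ (M + 1) * δ := by gcongr
        nlinarith
      have h1 := one_le_one_sub_mul_exp hkhalf
      have h2 : z s' * (1 - k) ≤ z s := by
        have := hstepz s hs s' hs' hlt.le
        linarith
      calc z s' ≤ z s' * ((1 - k) * Real.exp (k + 2 * k ^ 2)) :=
            le_mul_of_one_le_right (hz0 s' hs') h1
        _ = z s' * (1 - k) * Real.exp (k + 2 * k ^ 2) := by ring
        _ ≤ z s * Real.exp (k + 2 * k ^ 2) := by gcongr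
        _ ≤ z s * Real.exp (I + K * δ * (s' - s)) := by
          refine mul_le_mul_of_nonneg_left (Real.exp_le_exp.2 ?_) (hz0 s hs)
          rw [hk, hK] at *
          nlinarith
  have hlim : Tendsto
      (fun δ => A * Real.exp ((∫ x in Ico a b, c (tsFloor T x)) + K * δ * (b - a)))
      (𝓝[>] 0) (𝓝 (A * Real.exp (∫ x in Ico a b, c (tsFloor T x)))) := by
    have : Continuous
        (fun δ => A * Real.exp ((∫ x in Ico a b, c (tsFloor T x)) + K * δ * (b - a))) := by
      fun_prop
    simpa using (this.tendsto 0).mono_left nhdsWithin_le_nhds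
  refine ge_of_tendsto hlim ?_
  have hpos : 0 < 1 / 2 / (M + 1) ^ 2 := by positivity
  filter_upwards [Ioo_mem_nhdsGT hpos] with δ hδ
  exact key δ hδ.1 ((le_div_iff₀ (by positivity)).1 hδ.2.le)

end Gronwall

/-! ### Reduction of the two-variable inequality to one variable. -/

theorem theorem1 (T₁ T₂ : Set ℝ) (hT₁ : IsTimeScale T₁) (hT₂ : IsTimeScale T₂)
    (hT₁' : T₁.Nontrivial) (hT₂' : T₂.Nontrivial)
    (a₁ a₂ : ℝ) (ha₁ : a₁ ∈ T₁) (ha₂ : a₂ ∈ T₂)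
    (u a f : ℝ → ℝ → ℝ)
    (hu : ContinuousOn (fun x : ℝ × ℝ => u x.1 x.2) (tsIci T₁ a₁ ×ˢ tsIci T₂ a₂))
    (ha : ContinuousOn (fun x : ℝ × ℝ => a x.1 x.2) (tsIci T₁ a₁ ×ˢ tsIci T₂ a₂))
    (hf : ContinuousOn (fun x : ℝ × ℝ => f x.1 x.2) (tsIci T₁ a₁ ×ˢ tsIci T₂ a₂))
    (hu0 : ∀ t₁ ∈ tsIci T₁ a₁, ∀ t₂ ∈ tsIci T₂ a₂, 0 ≤ u t₁ t₂)
    (ha0 : ∀ t₁ ∈ tsIci T₁ a₁, ∀ t₂ ∈ tsIci T₂ a₂, 0 ≤ a t₁ t₂)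
    (hf0 : ∀ t₁ ∈ tsIci T₁ a₁, ∀ t₂ ∈ tsIci T₂ a₂, 0 ≤ f t₁ t₂)
    (hmono₁ : ∀ t₂ ∈ tsIci T₂ a₂, MonotoneOn (fun t₁ => a t₁ t₂) (tsIci T₁ a₁))
    (hmono₂ : ∀ t₁ ∈ tsIci T₁ a₁, MonotoneOn (fun t₂ => a t₁ t₂) (tsIci T₂ a₂))
    (hle : ∀ t₁ ∈ tsIci T₁ a₁, ∀ t₂ ∈ tsIci T₂ a₂,
      u t₁ t₂ ≤ a t₁ t₂ +
        deltaIntegral₂ T₁ T₂ (fun s₁ s₂ => f s₁ s₂ * u s₁ s₂) a₁ t₁ a₂ t₂) :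
    ∀ t₁ ∈ tsIci T₁ a₁, ∀ t₂ ∈ tsIci T₂ a₂,
      u t₁ t₂ ≤ a t₁ t₂ *
        deltaExp T₁ (fun s₁ => deltaIntegral T₂ (fun s₂ => f s₁ s₂) a₂ t₂) t₁ a₁ := by
  intro t₁ ht₁ t₂ ht₂
  have hT₁c := hT₁.2
  have hT₂c := hT₂.2
  have h₁ : a₁ ≤ t₁ := ht₁.1
  have h₂ : a₂ ≤ t₂ := ht₂.1
  have sub₁ : T₁ ∩ Icc a₁ t₁ ⊆ tsIci T₁ a₁ := fun s hs => ⟨hs.2.1, hs.1⟩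
  have sub₂ : T₂ ∩ Icc a₂ t₂ ⊆ tsIci T₂ a₂ := fun s hs => ⟨hs.2.1, hs.1⟩
  have half₁ : T₁ ∩ Ico a₁ t₁ ⊆ T₁ ∩ Icc a₁ t₁ := inter_subset_inter_right _ Ico_subset_Icc_self
  have half₂ : T₂ ∩ Ico a₂ t₂ ⊆ T₂ ∩ Icc a₂ t₂ := inter_subset_inter_right _ Ico_subset_Icc_self
  have hcomp : IsCompact ((T₁ ∩ Icc a₁ t₁) ×ˢ (T₂ ∩ Icc a₂ t₂)) :=
    (isCompact_Icc.inter_left hT₁c).prod (isCompact_Icc.inter_left hT₂c)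
  have hfc := hf.mono (prod_mono sub₁ sub₂)
  have hfuc := hfc.mul (hu.mono (prod_mono sub₁ sub₂))
  obtain ⟨M, hM⟩ := hcomp.exists_bound_of_continuousOn hfc
  obtain ⟨N, hN⟩ := hcomp.exists_bound_of_continuousOn hfuc
  have hfM : ∀ s ∈ T₁ ∩ Icc a₁ t₁, ∀ t ∈ T₂ ∩ Icc a₂ t₂, |f s t| ≤ M :=
    fun s hs t ht => hM (s, t) ⟨hs, ht⟩
  have hfuN : ∀ s ∈ T₁ ∩ Icc a₁ t₁, ∀ t ∈ T₂ ∩ Icc a₂ t₂, |f s t * u s t| ≤ N :=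
    fun s hs t ht => hN (s, t) ⟨hs, ht⟩
  have hM0 : 0 ≤ M := (abs_nonneg _).trans
    (hfM a₁ ⟨ha₁, le_rfl, h₁⟩ a₂ ⟨ha₂, le_rfl, h₂⟩)
  have hfu0 : ∀ s ∈ T₁ ∩ Icc a₁ t₁, ∀ t ∈ T₂ ∩ Icc a₂ t₂, 0 ≤ f s t * u s t :=
    fun s hs t ht => mul_nonneg (hf0 s (sub₁ hs) t (sub₂ ht)) (hu0 s (sub₁ hs) t (sub₂ ht))
  have hfl₁ : ∀ x ∈ Ico a₁ t₁, tsFloor T₁ x ∈ T₁ ∩ Ico a₁ t₁ :=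
    fun x hx => tsFloor_mem_Ico hT₁c ha₁ hx
  have hfl₂ : ∀ y ∈ Ico a₂ t₂, tsFloor T₂ y ∈ T₂ ∩ Ico a₂ t₂ :=
    fun y hy => tsFloor_mem_Ico hT₂c ha₂ hy
  -- sections in the second variable
  have hsec : ∀ g : ℝ → ℝ → ℝ, ContinuousOn (fun x : ℝ × ℝ => g x.1 x.2)
      ((T₁ ∩ Icc a₁ t₁) ×ˢ (T₂ ∩ Icc a₂ t₂)) → ∀ s ∈ T₁ ∩ Icc a₁ t₁,
      ContinuousOn (g s) (T₂ ∩ Ico a₂ t₂) := by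
    intro g hg s hs
    exact hg.comp (f := fun t => (s, t)) (by fun_prop) fun t ht => ⟨hs, half₂ ht⟩
  have hfint : ∀ s ∈ T₁ ∩ Icc a₁ t₁, IntegrableOn (fun y => f s (tsFloor T₂ y)) (Ico a₂ t₂) :=
    fun s hs => integrableOn_comp_tsFloor hT₂c ha₂ ht₂.2 h₂
      (fun t ht => hfM s hs t (half₂ ht)) fun t ht => Or.inr (hsec f hfc s hs t ht)
  have hfuint : ∀ s ∈ T₁ ∩ Icc a₁ t₁,
      IntegrableOn (fun y => f s (tsFloor T₂ y) * u s (tsFloor T₂ y)) (Ico a₂ t₂) :=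
    fun s hs => integrableOn_comp_tsFloor (g := fun t => f s t * u s t) hT₂c ha₂ ht₂.2 h₂
      (fun t ht => hfuN s hs t (half₂ ht))
      fun t ht => Or.inr (hsec (fun s t => f s t * u s t) hfuc s hs t ht)
  -- the coefficient of the one-variable inequality
  set p : ℝ → ℝ := fun s => deltaIntegral T₂ (fun t => f s t) a₂ t₂ with hpdef
  have hp : ∀ s ∈ T₁ ∩ Icc a₁ t₁, p s = ∫ y in Ico a₂ t₂, f s (tsFloor T₂ y) :=
    fun s hs => deltaIntegral_eq hT₂c ha₂ ht₂.2 h₂ (fun t ht => hfM s hs t (half₂ ht))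
      fun t ht => Or.inr (hsec f hfc s hs t ht)
  have hp0 : ∀ s ∈ T₁ ∩ Icc a₁ t₁, 0 ≤ p s := by
    intro s hs
    rw [hp s hs]
    exact setIntegral_nonneg measurableSet_Ico fun y hy =>
      hf0 s (sub₁ hs) _ (sub₂ (half₂ (hfl₂ y hy)))
  have hpM : ∀ s ∈ T₁ ∩ Icc a₁ t₁, p s ≤ M * (t₂ - a₂) := by
    intro s hs
    rw [hp s hs]
    refine (setIntegral_mono_on (hfint s hs) (integrableOn_const (C := M) (by simp))
      measurableSet_Ico fun y hy =>
        (le_abs_self _).trans (hfM s hs _ (half₂ (hfl₂ y hy)))).trans_eq ?_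
    simp [Real.volume_real_Ico_of_le h₂, mul_comm]
  have hpc : ContinuousOn p (T₁ ∩ Icc a₁ t₁) := by
    refine ContinuousOn.congr ?_ hp
    refine continuousOn_of_dominated (bound := fun _ => M)
      (fun s hs => (hfint s hs).aestronglyMeasurable) (fun s hs => ?_)
      (integrableOn_const (by simp)) ?_
    · refine (ae_restrict_iff' measurableSet_Ico).2 (Eventually.of_forall fun y hy => ?_)
      exact hfM s hs _ (half₂ (hfl₂ y hy))
    · refine (ae_restrict_iff' measurableSet_Ico).2 (Eventually.of_forall fun y hy => ?_)
      exact hfc.comp (f := fun s => (s, tsFloor T₂ y)) (by fun_prop)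
        fun s hs => ⟨hs, half₂ (hfl₂ y hy)⟩
  have hcM : ∀ s ∈ T₁ ∩ Ico a₁ t₁, |cylinder (graininess T₁ s) (p s)| ≤ M * (t₂ - a₂) := by
    intro s hs
    rw [abs_of_nonneg (cylinder_nonneg (graininess_nonneg T₁ s) (hp0 s (half₁ hs)))]
    exact (cylinder_le (graininess_nonneg T₁ s) (hp0 s (half₁ hs))).trans (hpM s (half₁ hs))
  have hcc : ∀ s ∈ T₁ ∩ Ico a₁ t₁, 0 < graininess T₁ s ∨
      ContinuousWithinAt (fun s => cylinder (graininess T₁ s) (p s)) (T₁ ∩ Ico a₁ t₁) s := by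
    intro s hs
    refine (graininess_nonneg T₁ s).lt_or_eq.imp id fun h => ?_
    exact continuousWithinAt_cylinder ht₁.2 (fun t ht => hp0 t (half₁ ht)) hs
      ((hpc s (half₁ hs)).mono half₁) h.symm
  -- the double integral as an iterated integral
  have hint₂ : IntegrableOn (fun x : ℝ × ℝ => f (tsFloor T₁ x.1) (tsFloor T₂ x.2) *
      u (tsFloor T₁ x.1) (tsFloor T₂ x.2)) (Ico a₁ t₁ ×ˢ Ico a₂ t₂) :=
    integrableOn_comp_tsFloor₂ (g := fun s t => f s t * u s t) hT₁c hT₂c ha₁ ha₂ ht₁.2 ht₂.2 h₁ h₂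
      (fun s hs t ht => hfuN s (half₁ hs) t (half₂ ht)) (hfuc.mono (prod_mono half₁ half₂))
  have heq₂ : ∀ s ∈ T₁ ∩ Icc a₁ t₁, ∀ t ∈ T₂ ∩ Icc a₂ t₂,
      deltaIntegral₂ T₁ T₂ (fun s₁ s₂ => f s₁ s₂ * u s₁ s₂) a₁ s a₂ t =
        ∫ x in Ico a₁ s ×ˢ Ico a₂ t, f (tsFloor T₁ x.1) (tsFloor T₂ x.2) *
          u (tsFloor T₁ x.1) (tsFloor T₂ x.2) := by
    intro s hs t ht
    have e₁ : T₁ ∩ Ico a₁ s ⊆ T₁ ∩ Icc a₁ t₁ := fun x hx =>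
      ⟨hx.1, hx.2.1, hx.2.2.le.trans hs.2.2⟩
    have e₂ : T₂ ∩ Ico a₂ t ⊆ T₂ ∩ Icc a₂ t₂ := fun x hx =>
      ⟨hx.1, hx.2.1, hx.2.2.le.trans ht.2.2⟩
    exact deltaIntegral₂_eq hT₁c hT₂c ha₁ ha₂ hs.1 ht.1 hs.2.1 ht.2.1
      (fun x hx y hy => hfuN x (e₁ hx) y (e₂ hy)) (hfuc.mono (prod_mono e₁ e₂))
  set q : ℝ → ℝ := fun s => ∫ y in Ico a₂ t₂, f s (tsFloor T₂ y) * u s (tsFloor T₂ y) with hqdef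
  have hqint : IntegrableOn (fun x => q (tsFloor T₁ x)) (Ico a₁ t₁) := by
    have := hint₂
    rw [IntegrableOn, Measure.volume_eq_prod, ← Measure.prod_restrict] at this
    exact this.integral_prod_left
  have hiter : ∀ s ∈ T₁ ∩ Icc a₁ t₁,
      ∫ x in Ico a₁ s ×ˢ Ico a₂ t₂, f (tsFloor T₁ x.1) (tsFloor T₂ x.2) *
          u (tsFloor T₁ x.1) (tsFloor T₂ x.2) = ∫ x in Ico a₁ s, q (tsFloor T₁ x) := by
    intro s hs
    exact setIntegral_prod _ (hint₂.mono_set (prod_mono (Ico_subset_Ico le_rfl hs.2.2) subset_rfl))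
  -- Moving `a` to the corner `(t₁, t₂)` and extending the inner integral to `t₂` makes the bound
  -- independent of `t`.
  have huz : ∀ s ∈ T₁ ∩ Icc a₁ t₁, ∀ t ∈ T₂ ∩ Icc a₂ t₂,
      u s t ≤ a t₁ t₂ + ∫ x in Ico a₁ s, q (tsFloor T₁ x) := by
    intro s hs t ht
    refine (hle s (sub₁ hs) t (sub₂ ht)).trans (add_le_add ?_ ?_)
    · exact (hmono₁ t (sub₂ ht) (sub₁ hs) ht₁ hs.2.2).trans (hmono₂ t₁ ht₁ (sub₂ ht) ht₂ ht.2.2)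
    · rw [heq₂ s hs t ht, ← hiter s hs]
      have hsubs : Ico a₁ s ×ˢ Ico a₂ t₂ ⊆ Ico a₁ t₁ ×ˢ Ico a₂ t₂ :=
        prod_mono (Ico_subset_Ico le_rfl hs.2.2) subset_rfl
      refine setIntegral_mono_set (hint₂.mono_set hsubs) ?_
        (prod_mono subset_rfl (Ico_subset_Ico le_rfl ht.2.2)).eventuallyLE
      refine (ae_restrict_iff' (measurableSet_Ico.prod measurableSet_Ico)).2
        (Eventually.of_forall fun x hx => ?_)
      have hx' := hsubs hx
      exact hfu0 _ (half₁ (hfl₁ _ hx'.1)) _ (half₂ (hfl₂ _ hx'.2))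
  -- As the bound on `u` does not depend on `y`, it factors out of the inner integral and leaves `p
  -- s`.
  have hqz : ∀ s ∈ T₁ ∩ Ico a₁ t₁, q s ≤ p s * (a t₁ t₂ + ∫ x in Ico a₁ s, q (tsFloor T₁ x)) := by
    intro s hs
    have hs' := half₁ hs
    rw [hp s hs', ← integral_mul_const]
    refine setIntegral_mono_on (hfuint s hs') ((hfint s hs').mul_const _) measurableSet_Ico
      fun y hy => ?_
    have hy' := half₂ (hfl₂ y hy)
    exact mul_le_mul_of_nonneg_left (huz s hs' _ hy') (hf0 s (sub₁ hs') _ (sub₂ hy'))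
  have hgron := le_mul_exp_setIntegral_cylinder hT₁c ha₁ ht₁.2 h₁ (p := p) (q := q)
    (z := fun s => a t₁ t₂ + ∫ x in Ico a₁ s, q (tsFloor T₁ x)) (ha0 t₁ ht₁ t₂ ht₂)
    (mul_nonneg hM0 (sub_nonneg.2 h₂)) (fun s hs => hp0 s (half₁ hs))
    (fun s hs => hpM s (half₁ hs))
    (integrableOn_comp_tsFloor (g := fun s => cylinder (graininess T₁ s) (p s))
      hT₁c ha₁ ht₁.2 h₁ hcM hcc) hqint
    (fun s hs => setIntegral_nonneg measurableSet_Ico fun y hy =>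
      hfu0 s (half₁ hs) _ (half₂ (hfl₂ y hy)))
    (fun s hs => rfl) hqz
  rw [deltaExp, deltaIntegral_eq hT₁c ha₁ ht₁.2 h₁ hcM hcc]
  exact (huz t₁ ⟨ht₁.2, h₁, le_rfl⟩ t₂ ⟨ht₂.2, h₂, le_rfl⟩).trans hgron
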